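/- Let $V:\mathbb{R}\to\mathbb{R}$ be continuous. Let $$H^{1/2}(\mathbb{R})=\Big\{u\in L^2(\mathbb{R}) : \tfrac{|u(x)-u(y)|}{|x-y|}\in L^2(\mathbb{R}\times\mathbb{R})\Big\},\qquad X=\Big\{u\in H^{1/2}(\mathbb{R}) : \int_{\mathbb{R}}V(x)u^2\,dx<\infty\Big\},$$ where all functions are real-valued, and suppose that: $(V_1)$ there is a constant $B>0$ such that $V(x)\ge -B$ for all $x\in\mathbb{R}$; $(V_2)$ the infimum $$\lambda_1:=\inf_{u\in X,\ \|u\|_2=1}\Big(\frac1{2\pi}\int_{\mathbb{R}^2}\frac{(u(x)-u(y))^2}{|x-y|^2}\,dx\,dy+\int_{\mathbb{R}}V(x)u^2\,dx\Big)$$ is positive; $(V_3)$ $\lim_{R\to\infty}\nu(\mathbb{R}\setminus\overline B_R)=+\infty$, where $\overline B_R=[-R,R]$ and, for a nonempty open set $G\subseteq\mathbb{R}$, $$\nu(G):=\inf_{u\in X_0(G),\ \|u\|_2=1}\Big(\frac1{2\pi}\int_{\mathbb{R}^2}\frac{(u(x)-u(y))^2}{|x-y|^2}\,dx\,dy+\int_{G}V(x)u^2\,dx\Big),\qquad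 X_0(G)=\{u\in X : u=0 \text{ a.e. in } \mathbb{R}\setminus G\},$$ and $\nu(\varnothing):=+\infty$. Equip $X$ with the norm $$\|u\|=\Big(\frac1{2\pi}\int_{\mathbb{R}^2}\frac{(u(x)-u(y))^2}{|x-y|^2}\,dx\,dy+\int_{\mathbb{R}}V(x)u^2\,dx\Big)^{1/2}.$$ Then for every $q\in[2,\infty)$ the space $X$ is compactly embedded into $L^q(\mathbb{R})$: $X\subset L^q(\mathbb{R})$, there is a constant $C$ with $\|u\|_q\le C\|u\|$ for all $u\in X$, and every sequence that is bounded in $X$ has a subsequence that converges in $L^q(\mathbb{R})$. -/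

import Mathlib

open MeasureTheory Filter Topology
open scoped ENNReal

noncomputable section

namespace FracSchrodinger

/-- Membership in `H^{1/2}(ℝ)`: `u ∈ L²(ℝ)` and `|u(x) - u(y)| / |x - y| ∈ L²(ℝ × ℝ)`.
Functions are representatives of their almost-everywhere classes. -/
def MemHHalf (u : ℝ → ℝ) : Prop :=
  MemLp u 2 volume ∧
    MemLp (fun p : ℝ × ℝ => |u p.1 - u p.2| / |p.1 - p.2|) 2 volume

/-- The squared Gagliardo semi-norm `[u]²_{1/2,2}`. -/
def gagliardoSq (u : ℝ → ℝ) : ℝ :=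
  ∫ p : ℝ × ℝ, (u p.1 - u p.2) ^ 2 / |p.1 - p.2| ^ 2

/-- The space `X = {u ∈ H^{1/2}(ℝ) : ∫ V u² < ∞}`. For `V` bounded below and `u ∈ L²`, the
negative part of `V u²` is integrable, so `∫ V u² < ∞` says exactly that `V u²` is integrable. -/
def spaceX (V : ℝ → ℝ) : Set (ℝ → ℝ) :=
  {u | MemHHalf u ∧ Integrable (fun x => V x * u x ^ 2) volume}

/-- The quadratic form `(1/2π) ∬ (u(x) - u(y))² / |x - y|² dx dy + ∫_G V u² dx`. -/
def energyOn (V : ℝ → ℝ) (G : Set ℝ) (u : ℝ → ℝ) : ℝ :=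
  1 / (2 * Real.pi) * gagliardoSq u + ∫ x in G, V x * u x ^ 2

/-- The quadratic form `(1/2π) ∬ (u(x) - u(y))² / |x - y|² dx dy + ∫_ℝ V u² dx`. -/
def energy (V : ℝ → ℝ) (u : ℝ → ℝ) : ℝ :=
  1 / (2 * Real.pi) * gagliardoSq u + ∫ x, V x * u x ^ 2

/-- The norm `‖u‖` of `X`, the square root of the quadratic form. -/
def normX (V : ℝ → ℝ) (u : ℝ → ℝ) : ℝ :=
  Real.sqrt (energy V u)

/-- `X₀(G) = {u ∈ X : u = 0 in ℝ \ G}`, the equality being almost everywhere. -/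
def spaceX0 (V : ℝ → ℝ) (G : Set ℝ) : Set (ℝ → ℝ) :=
  {u | u ∈ spaceX V ∧ ∀ᵐ x ∂(volume : Measure ℝ), x ∉ G → u x = 0}

/-- `λ₁`, an infimum in the extended reals (so the infimum of the empty set is `+∞`). -/
def lambda1 (V : ℝ → ℝ) : EReal :=
  ⨅ u ∈ {u : ℝ → ℝ | u ∈ spaceX V ∧ eLpNorm u 2 volume = 1}, ((energy V u : ℝ) : EReal)

open Classical in
/-- `ν(G)`, an infimum in the extended reals, with `ν(∅) = +∞`. -/
def nu (V : ℝ → ℝ) (G : Set ℝ) : EReal :=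
  if G.Nonempty then
    ⨅ u ∈ {u : ℝ → ℝ | u ∈ spaceX0 V G ∧ eLpNorm u 2 volume = 1},
      ((energyOn V G u : ℝ) : EReal)
  else ⊤

/-- `(V₁)`: the potential is bounded below. -/
def CondV1 (V : ℝ → ℝ) : Prop :=
  ∃ B : ℝ, 0 < B ∧ ∀ x, -B ≤ V x

/-- `(V₂)`: the infimum `λ₁` is positive. -/
def CondV2 (V : ℝ → ℝ) : Prop :=
  0 < lambda1 V

/-- `(V₃)`: `ν(ℝ \ closedBall 0 R) → +∞` as `R → ∞`. -/
def CondV3 (V : ℝ → ℝ) : Prop :=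
  Tendsto (fun R : ℝ => nu V (Metric.closedBall (0 : ℝ) R)ᶜ) atTop (𝓝 (⊤ : EReal))

/-- A space `S` of functions with norm `N` is compactly embedded into `L^q(ℝ)`: it is contained
in `L^q(ℝ)`, the inclusion is continuous, and every `N`-bounded sequence in `S` has a subsequence
that converges in `L^q(ℝ)`. -/
def CompactlyEmbedded (S : Set (ℝ → ℝ)) (N : (ℝ → ℝ) → ℝ) (q : ℝ≥0∞) : Prop :=
  (∀ u ∈ S, MemLp u q volume) ∧
  (∃ C : ℝ, ∀ u ∈ S, eLpNorm u q volume ≤ ENNReal.ofReal (C * N u)) ∧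
  (∀ u : ℕ → ℝ → ℝ, (∀ n, u n ∈ S) → (∃ M : ℝ, ∀ n, N (u n) ≤ M) →
    ∃ (v : ℝ → ℝ) (φ : ℕ → ℕ), MemLp v q volume ∧ StrictMono φ ∧
      Tendsto (fun n => eLpNorm (fun x => u (φ n) x - v x) q volume) atTop (𝓝 0))

end FracSchrodinger

end

namespace FracSchrodinger

/-! By `(V₂)` the form dominates a multiple of `∫ u²`, and then by `(V₁)` it also dominates the
Gagliardo semi-norm (`exists_bound_of_energy`). On sets bounded in that semi-norm, `‖u‖_q^q` is at
most a constant times any positive bound for `∫ u²` (`exists_eLpNorm_rpow_le`), by iterating a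
pointwise Chebyshev estimate that raises the exponent by two. This gives the embedding, and it
reduces compactness to finding a subsequence that is Cauchy in `L²`.

Mass far out is uniformly small: a cutoff `w` of `u` outside `[-R, R]` has energy bounded
independently of `R`, while `(V₃)` bounds that energy below by an arbitrarily large multiple of `∫
w²` (`exists_tail_le`).

On a bounded interval, a function is compared with its means over cells of length `s`; the error in
`∫ u²` is at most `2 s` times the squared semi-norm (`sq_le_gagliardoDensity_add_sq_average`). Only
finitely many means remain at each scale, and all of them, at all scales, converge along one
subsequence. Rellich's theorem is thus not needed. -/

/-- The inner integral `∫ (u(x) - u(y))² / |x - y|² dy` of the Gagliardo semi-norm. -/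
noncomputable def gagliardoDensity (u : ℝ → ℝ) (x : ℝ) : ℝ≥0∞ :=
  ∫⁻ y, ENNReal.ofReal ((u x - u y) ^ 2 / |x - y| ^ 2)

/-- The squared Gagliardo semi-norm with values in `[0, ∞]`. -/
noncomputable def lgagliardoSq (u : ℝ → ℝ) : ℝ≥0∞ :=
  ∫⁻ x, gagliardoDensity u x

/-- The integral `∫ |u|^p` with values in `[0, ∞]`. -/
noncomputable def lpow (p : ℕ) (u : ℝ → ℝ) : ℝ≥0∞ :=
  ∫⁻ x, ENNReal.ofReal (|u x| ^ p)

/-! ### Measurability, and passage to integrals with values in `[0, ∞]` -/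

theorem aemeasurable_gagliardoKernel {u : ℝ → ℝ} (hu : AEMeasurable u) :
    AEMeasurable (fun p : ℝ × ℝ => ENNReal.ofReal ((u p.1 - u p.2) ^ 2 / |p.1 - p.2| ^ 2))
      (volume.prod volume) := by
  have h1 : AEMeasurable (fun p : ℝ × ℝ => u p.1) (volume.prod volume) :=
    hu.comp_quasiMeasurePreserving Measure.quasiMeasurePreserving_fst
  have h2 : AEMeasurable (fun p : ℝ × ℝ => u p.2) (volume.prod volume) :=
    hu.comp_quasiMeasurePreserving Measure.quasiMeasurePreserving_snd
  have h3 : Measurable (fun p : ℝ × ℝ => |p.1 - p.2| ^ 2) := by fun_prop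
  exact (((h1.sub h2).pow_const 2).div h3.aemeasurable).ennreal_ofReal

theorem lgagliardoSq_eq_lintegral_prod {u : ℝ → ℝ} (hu : AEMeasurable u) :
    lgagliardoSq u =
      ∫⁻ p : ℝ × ℝ, ENNReal.ofReal ((u p.1 - u p.2) ^ 2 / |p.1 - p.2| ^ 2) :=
  (lintegral_prod _ (aemeasurable_gagliardoKernel hu)).symm

theorem aemeasurable_gagliardoDensity {u : ℝ → ℝ} (hu : AEMeasurable u) :
    AEMeasurable (gagliardoDensity u) :=
  (aemeasurable_gagliardoKernel hu).lintegral_prod_right'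

theorem memLp_two_iff_lintegral {α : Type*} [MeasurableSpace α] {μ : Measure α} {f : α → ℝ} :
    MemLp f 2 μ ↔ AEStronglyMeasurable f μ ∧ ∫⁻ x, ENNReal.ofReal (f x ^ 2) ∂μ < ∞ := by
  unfold MemLp
  refine and_congr_right fun _ => ?_
  rw [eLpNorm_lt_top_iff_lintegral_rpow_enorm_lt_top (by norm_num) (by norm_num)]
  have : ∀ x, ‖f x‖ₑ ^ (2 : ℝ≥0∞).toReal = ENNReal.ofReal (f x ^ 2) := fun x => by
    rw [← ofReal_norm, ENNReal.ofReal_rpow_of_nonneg (norm_nonneg _) (by norm_num)]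
    simp
  simp_rw [this]

/-- In this form Tonelli and monotonicity apply without integrability side conditions; the estimates
below are made on the extended integrals. -/
theorem memHHalf_iff {u : ℝ → ℝ} :
    MemHHalf u ↔ AEStronglyMeasurable u ∧ lpow 2 u < ∞ ∧ lgagliardoSq u < ∞ := by
  unfold MemHHalf lpow
  rw [memLp_two_iff_lintegral, memLp_two_iff_lintegral]
  simp only [div_pow, sq_abs]
  constructor
  · rintro ⟨⟨h1, h2⟩, -, h3⟩
    refine ⟨h1, h2, ?_⟩
    rw [lgagliardoSq_eq_lintegral_prod h1.aemeasurable]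
    simpa only [sq_abs] using h3
  · rintro ⟨h1, h2, h3⟩
    rw [lgagliardoSq_eq_lintegral_prod h1.aemeasurable] at h3
    refine ⟨⟨h1, h2⟩, ?_, by simpa only [sq_abs] using h3⟩
    have h1' : AEMeasurable (fun p : ℝ × ℝ => u p.1) (volume.prod volume) :=
      h1.aemeasurable.comp_quasiMeasurePreserving Measure.quasiMeasurePreserving_fst
    have h2' : AEMeasurable (fun p : ℝ × ℝ => u p.2) (volume.prod volume) :=
      h1.aemeasurable.comp_quasiMeasurePreserving Measure.quasiMeasurePreserving_snd
    have h3' : Measurable (fun p : ℝ × ℝ => |p.1 - p.2|) := by fun_prop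
    exact ((continuous_abs.measurable.comp_aemeasurable (h1'.sub h2')).div
      h3'.aemeasurable).aestronglyMeasurable

theorem MemHHalf.ofReal_gagliardoSq {u : ℝ → ℝ} (hu : MemHHalf u) :
    ENNReal.ofReal (gagliardoSq u) = lgagliardoSq u := by
  have h := memHHalf_iff.1 hu
  have h3 := h.2.2
  rw [lgagliardoSq_eq_lintegral_prod h.1.aemeasurable] at h3 ⊢
  unfold gagliardoSq
  have hk : AEStronglyMeasurable
      (fun p : ℝ × ℝ => (u p.1 - u p.2) ^ 2 / |p.1 - p.2| ^ 2) volume := by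
    have := (hu.2.1.aemeasurable.pow_const 2).aestronglyMeasurable
    simpa only [div_pow, sq_abs] using this
  rw [integral_eq_lintegral_of_nonneg_ae (ae_of_all _ fun p => by positivity) hk,
    ENNReal.ofReal_toReal h3.ne]

theorem gagliardoSq_nonneg (u : ℝ → ℝ) : 0 ≤ gagliardoSq u :=
  integral_nonneg fun _ => by positivity

theorem MemLp.ofReal_integral_sq {u : ℝ → ℝ} (hu : MemLp u 2 volume) :
    ENNReal.ofReal (∫ x, u x ^ 2) = lpow 2 u := by
  unfold lpow
  simp only [sq_abs]
  exact ofReal_integral_eq_lintegral_ofReal hu.integrable_sq (ae_of_all _ fun x => sq_nonneg _)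

/-! ### Moment bounds from the Gagliardo semi-norm -/

/-- The elementary pointwise bound behind the Sobolev embedding of `H^{1/2}(ℝ)`. -/
theorem pow_le_gagliardoDensity {u : ℝ → ℝ} (hu : AEMeasurable u) {p : ℕ} {J : ℝ} (hJ : 0 < J)
    (hI : lpow p u ≤ ENNReal.ofReal J) (x : ℝ) :
    ENNReal.ofReal (|u x| ^ (p + 2)) ≤
      ENNReal.ofReal (2 ^ (p + 4) * J) * gagliardoDensity u x := by
  rcases eq_or_ne (gagliardoDensity u x) ∞ with hG | hG
  · rw [hG, ENNReal.mul_top]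
    · exact le_top
    · simpa using by positivity
  rcases eq_or_ne (u x) 0 with h0 | h0
  · simp [h0]
  have ha : 0 < |u x| := abs_pos.2 h0
  set a := |u x| with ha_def
  -- By Chebyshev, `|u| ≥ a / 2` on a set of measure at most `(2 / a) ^ p * J`. With `h` twice this,
  -- at least half of `(x, x + h)` consists of `y` with `|u x - u y| ≥ a / 2` and `|x - y| ≤ h`,
  -- where the kernel is at least `a ^ 2 / (4 * h ^ 2)`.
  set h : ℝ := 2 * (2 / a) ^ p * J with hh_def
  have hh : 0 < h := by positivity
  have key : ENNReal.ofReal h ≤ ENNReal.ofReal ((2 / a) ^ p) * lpow p u +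
      ENNReal.ofReal (4 * h ^ 2 / a ^ 2) * gagliardoDensity u x := by
    unfold lpow gagliardoDensity
    rw [← lintegral_const_mul'' _ (by fun_prop), ← lintegral_const_mul' _ _ (by simp),
      ← lintegral_add_left' (by fun_prop)]
    calc ENNReal.ofReal h = ∫⁻ y in Set.Ioo x (x + h), 1 := by simp
      _ ≤ ∫⁻ y in Set.Ioo x (x + h), (ENNReal.ofReal ((2 / a) ^ p) * ENNReal.ofReal (|u y| ^ p) +
          ENNReal.ofReal (4 * h ^ 2 / a ^ 2) *
            ENNReal.ofReal ((u x - u y) ^ 2 / |x - y| ^ 2)) := by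
          refine setLIntegral_mono' measurableSet_Ioo fun y hy => ?_
          rcases le_total (a / 2) |u y| with hc | hc
          · refine le_add_right ?_
            rw [← ENNReal.ofReal_mul (by positivity), ← mul_pow, ENNReal.one_le_ofReal]
            refine one_le_pow₀ ?_
            rw [div_mul_eq_mul_div, le_div_iff₀ ha]; linarith
          · refine le_add_left ?_
            rw [← ENNReal.ofReal_mul (by positivity), ENNReal.one_le_ofReal]
            have h1 : a / 2 ≤ |u x - u y| := by
              have := abs_sub_abs_le_abs_sub (u x) (u y)
              linarith
            have h2 : (a / 2) ^ 2 ≤ (u x - u y) ^ 2 := by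
              rw [← sq_abs (u x - u y)]; gcongr
            have h3 : |x - y| ^ 2 ≤ h ^ 2 := by
              have : |x - y| ≤ h := by rw [abs_le]; constructor <;> linarith [hy.1, hy.2]
              gcongr
            have h4 : 0 < |x - y| ^ 2 := by
              have : x - y ≠ 0 := by linarith [hy.1] |> fun h : x - y < 0 => h.ne
              positivity
            rw [div_mul_div_comm, one_le_div (by positivity)]
            nlinarith [mul_le_mul h3 h2 (by positivity) (by positivity), h3, h2, sq_nonneg a]
      _ ≤ _ := setLIntegral_le_lintegral _ _
  have key2 : ENNReal.ofReal h ≤ ENNReal.ofReal (h / 2) +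
      ENNReal.ofReal (4 * h ^ 2 / a ^ 2) * gagliardoDensity u x := by
    refine key.trans (add_le_add_left ?_ _)
    calc _ ≤ ENNReal.ofReal ((2 / a) ^ p) * ENNReal.ofReal J := by gcongr
      _ = ENNReal.ofReal (h / 2) := by
        rw [← ENNReal.ofReal_mul (by positivity)]; congr 1; rw [hh_def]; ring
  obtain ⟨g, hg, hgG⟩ : ∃ g : ℝ, 0 ≤ g ∧ gagliardoDensity u x = ENNReal.ofReal g :=
    ⟨_, ENNReal.toReal_nonneg, (ENNReal.ofReal_toReal hG).symm⟩
  rw [hgG, ← ENNReal.ofReal_mul (by positivity), ← ENNReal.ofReal_add (by positivity)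
    (by positivity), ENNReal.ofReal_le_ofReal_iff (by positivity)] at key2
  rw [hgG, ← ENNReal.ofReal_mul (by positivity)]
  refine ENNReal.ofReal_le_ofReal ?_
  have e1 : 1 ≤ 8 * h / a ^ 2 * g := by
    have : h * 1 ≤ h * (8 * h / a ^ 2 * g) := by
      have : h * (8 * h / a ^ 2 * g) = 2 * (4 * h ^ 2 / a ^ 2 * g) := by ring
      linarith
    exact le_of_mul_le_mul_left this hh
  have e2 : 8 * h / a ^ 2 * g = 2 ^ (p + 4) * J * g / a ^ (p + 2) := by
    rw [hh_def, div_pow]; field_simp; ring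
  rw [e2, one_le_div (by positivity)] at e1
  exact e1

theorem lpow_add_two_le {u : ℝ → ℝ} (hu : AEMeasurable u) {p : ℕ} {J : ℝ} (hJ : 0 < J)
    (hI : lpow p u ≤ ENNReal.ofReal J) :
    lpow (p + 2) u ≤ ENNReal.ofReal (2 ^ (p + 4) * J) * lgagliardoSq u := by
  unfold lgagliardoSq
  rw [← lintegral_const_mul' _ _ ENNReal.ofReal_ne_top]
  exact lintegral_mono fun x => pow_le_gagliardoDensity hu hJ hI x

/-- Control of all even moments by `∫ u²` and the Gagliardo semi-norm. -/
theorem exists_lpow_even_le (k : ℕ) (N : ℝ) (hN : 0 < N) : ∃ c : ℝ, 0 < c ∧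
    ∀ u : ℝ → ℝ, AEMeasurable u → lgagliardoSq u ≤ ENNReal.ofReal N →
      ∀ δ : ℝ, 0 < δ → lpow 2 u ≤ ENNReal.ofReal δ →
        lpow (2 * k + 2) u ≤ ENNReal.ofReal (c * δ) := by
  induction k with
  | zero => exact ⟨1, one_pos, fun u _ _ δ _ h => by simpa using h⟩
  | succ k ih =>
    obtain ⟨c, hc, ih⟩ := ih
    -- Each step uses the previous moment as `J`, so the bound stays linear in `δ`; this is what
    -- later turns `L²` smallness into `L^q` smallness.
    refine ⟨2 ^ (2 * k + 2 + 4) * c * N, by positivity, fun u hu hE δ hδ h => ?_⟩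
    calc lpow (2 * k + 2 + 2) u
        ≤ ENNReal.ofReal (2 ^ (2 * k + 2 + 4) * (c * δ)) * lgagliardoSq u :=
          lpow_add_two_le hu (by positivity) (ih u hu hE δ hδ h)
      _ ≤ ENNReal.ofReal (2 ^ (2 * k + 2 + 4) * (c * δ)) * ENNReal.ofReal N := by gcongr
      _ = _ := by rw [← ENNReal.ofReal_mul (by positivity)]; congr 1; ring

/-- `‖u‖_q^q` is controlled by `‖u‖_2²` on sets that are bounded in the Gagliardo semi-norm. -/
theorem exists_eLpNorm_rpow_le (q : ℝ) (hq : 2 ≤ q) (N : ℝ) (hN : 0 < N) : ∃ c : ℝ, 0 < c ∧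
    ∀ u : ℝ → ℝ, AEMeasurable u → lgagliardoSq u ≤ ENNReal.ofReal N →
      ∀ δ : ℝ, 0 < δ → lpow 2 u ≤ ENNReal.ofReal δ →
        eLpNorm u (ENNReal.ofReal q) volume ≤ ENNReal.ofReal ((c * δ) ^ (1 / q)) := by
  -- As `2 ≤ q ≤ 2 * k + 2`, the power `|t| ^ q` is at most `|t| ^ 2 + |t| ^ (2 * k + 2)`.
  obtain ⟨k, hk⟩ := exists_nat_ge q
  obtain ⟨c, hc, H⟩ := exists_lpow_even_le k N hN
  refine ⟨1 + c, by positivity, fun u hu hE δ hδ h => ?_⟩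
  have hq0 : 0 < q := by linarith
  rw [eLpNorm_eq_lintegral_rpow_enorm_toReal (by simpa using hq0) (by simp),
    ENNReal.toReal_ofReal hq0.le, ← ENNReal.ofReal_rpow_of_nonneg (by positivity) (by positivity)]
  gcongr
  calc ∫⁻ x, ‖u x‖ₑ ^ q
      ≤ ∫⁻ x, (ENNReal.ofReal (|u x| ^ 2) + ENNReal.ofReal (|u x| ^ (2 * k + 2))) := by
        refine lintegral_mono fun x => ?_
        rw [← ofReal_norm, ENNReal.ofReal_rpow_of_nonneg (norm_nonneg _) hq0.le,
          ← ENNReal.ofReal_add (by positivity) (by positivity)]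
        refine ENNReal.ofReal_le_ofReal ?_
        rw [Real.norm_eq_abs]
        rcases le_total |u x| 1 with h1 | h1
        · have : |u x| ^ q ≤ |u x| ^ (2 : ℝ) := by
            rcases (abs_nonneg (u x)).eq_or_lt with h0 | h0
            · rw [← h0, Real.zero_rpow hq0.ne', Real.zero_rpow two_ne_zero]
            · exact Real.rpow_le_rpow_of_exponent_ge h0 h1 hq
          rw [Real.rpow_two] at this
          have : 0 ≤ |u x| ^ (2 * k + 2) := by positivity
          linarith
        · have : |u x| ^ q ≤ |u x| ^ ((2 * k + 2 : ℕ) : ℝ) :=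
            Real.rpow_le_rpow_of_exponent_le h1 (by push_cast; linarith)
          rw [Real.rpow_natCast] at this
          have : 0 ≤ |u x| ^ 2 := by positivity
          linarith
    _ = lpow 2 u + lpow (2 * k + 2) u := lintegral_add_left' (by fun_prop) _
    _ ≤ ENNReal.ofReal δ + ENNReal.ofReal (c * δ) := add_le_add h (H u hu hE δ hδ h)
    _ = ENNReal.ofReal ((1 + c) * δ) := by
        rw [← ENNReal.ofReal_add (by positivity) (by positivity)]; congr 1; ring

/-! ### Algebraic operations -/

theorem lpow_two_const_mul (c : ℝ) (u : ℝ → ℝ) :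
    lpow 2 (fun x => c * u x) = ENNReal.ofReal (c ^ 2) * lpow 2 u := by
  unfold lpow
  rw [← lintegral_const_mul' _ _ (by simp)]
  refine lintegral_congr fun x => ?_
  rw [← ENNReal.ofReal_mul (by positivity), sq_abs, sq_abs, mul_pow]

theorem lgagliardoSq_const_mul (c : ℝ) (u : ℝ → ℝ) :
    lgagliardoSq (fun x => c * u x) = ENNReal.ofReal (c ^ 2) * lgagliardoSq u := by
  unfold lgagliardoSq gagliardoDensity
  rw [← lintegral_const_mul' _ _ (by simp)]
  refine lintegral_congr fun x => ?_
  rw [← lintegral_const_mul' _ _ (by simp)]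
  refine lintegral_congr fun y => ?_
  rw [← ENNReal.ofReal_mul (by positivity)]
  congr 1; ring

theorem gagliardoSq_const_mul (c : ℝ) (u : ℝ → ℝ) :
    gagliardoSq (fun x => c * u x) = c ^ 2 * gagliardoSq u := by
  unfold gagliardoSq
  rw [← integral_const_mul]
  congr 1; ext p; ring

theorem MemHHalf.const_mul {u : ℝ → ℝ} (hu : MemHHalf u) (c : ℝ) :
    MemHHalf (fun x => c * u x) := by
  obtain ⟨h1, h2, h3⟩ := memHHalf_iff.1 hu
  refine memHHalf_iff.2 ⟨h1.const_mul c, ?_, ?_⟩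
  · rw [lpow_two_const_mul]; exact ENNReal.mul_lt_top (by simp) h2
  · rw [lgagliardoSq_const_mul]; exact ENNReal.mul_lt_top (by simp) h3

theorem spaceX_const_mul {V u : ℝ → ℝ} (hu : u ∈ spaceX V) (c : ℝ) :
    (fun x => c * u x) ∈ spaceX V := by
  refine ⟨hu.1.const_mul c, (hu.2.const_mul (c ^ 2)).congr (ae_of_all _ fun x => ?_)⟩
  ring

theorem spaceX0_const_mul {V u : ℝ → ℝ} {G : Set ℝ} (hu : u ∈ spaceX0 V G) (c : ℝ) :
    (fun x => c * u x) ∈ spaceX0 V G := by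
  refine ⟨spaceX_const_mul hu.1 c, hu.2.mono fun x hx h => ?_⟩
  simp [hx h]

theorem energyOn_const_mul (V : ℝ → ℝ) (G : Set ℝ) (c : ℝ) (u : ℝ → ℝ) :
    energyOn V G (fun x => c * u x) = c ^ 2 * energyOn V G u := by
  unfold energyOn
  rw [gagliardoSq_const_mul, mul_add, ← integral_const_mul]
  congr 1
  · ring
  · congr 1; ext x; ring

theorem lgagliardoSq_sub_le {u v : ℝ → ℝ} (hu : AEMeasurable u) (hv : AEMeasurable v) :
    lgagliardoSq (fun x => u x - v x) ≤ 2 * lgagliardoSq u + 2 * lgagliardoSq v := by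
  have hm : AEMeasurable (fun p : ℝ × ℝ =>
      2 * ENNReal.ofReal ((u p.1 - u p.2) ^ 2 / |p.1 - p.2| ^ 2)) volume :=
    (aemeasurable_gagliardoKernel hu).const_mul _
  rw [lgagliardoSq_eq_lintegral_prod hu, lgagliardoSq_eq_lintegral_prod hv,
    lgagliardoSq_eq_lintegral_prod (u := fun x => u x - v x) (hu.sub hv), ← lintegral_const_mul' _ _ (by simp),
    ← lintegral_const_mul' _ _ (by simp),
    ← lintegral_add_left' hm]
  refine lintegral_mono fun p => ?_
  rw [show (2 : ℝ≥0∞) = ENNReal.ofReal 2 by simp, ← ENNReal.ofReal_mul (by positivity),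
    ← ENNReal.ofReal_mul (by positivity), ← ENNReal.ofReal_add (by positivity) (by positivity)]
  refine ENNReal.ofReal_le_ofReal ?_
  rw [← mul_div_assoc, ← mul_div_assoc, ← add_div]
  gcongr
  nlinarith [sq_nonneg ((u p.1 - u p.2) + (v p.1 - v p.2))]

/-! ### Lower bounds for the energy -/

/-- Both sides are homogeneous of degree two, so the unit sphere suffices. A function of zero mass
cannot be normalised, but its potential term vanishes and the semi-norm is nonnegative. -/
theorem mul_integral_sq_le_energyOn {V : ℝ → ℝ} {G : Set ℝ} {K : ℝ}
    (hK : ∀ v ∈ spaceX0 V G, eLpNorm v 2 volume = 1 → K ≤ energyOn V G v)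
    {u : ℝ → ℝ} (hu : u ∈ spaceX0 V G) : K * ∫ x, u x ^ 2 ≤ energyOn V G u := by
  have hL2 : MemLp u 2 volume := hu.1.1.1
  rcases (integral_nonneg fun x => sq_nonneg (u x) :
    0 ≤ ∫ x, u x ^ 2).eq_or_lt with h0 | h0
  · rw [← h0, mul_zero]
    have hz : (fun x => u x ^ 2) =ᵐ[volume] 0 :=
      (integral_eq_zero_iff_of_nonneg (fun x => sq_nonneg _) hL2.integrable_sq).1 h0.symm
    have : ∫ x in G, V x * u x ^ 2 = 0 := by
      rw [integral_eq_zero_of_ae]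
      filter_upwards [ae_restrict_of_ae hz] with x hx
      simp only [Pi.zero_apply] at hx ⊢
      rw [hx, mul_zero]
    unfold energyOn
    rw [this]
    have := gagliardoSq_nonneg u
    positivity
  · set t := ∫ x, u x ^ 2 with ht
    set c : ℝ := 1 / Real.sqrt t with hc
    have hc2 : c ^ 2 = 1 / t := by rw [hc, div_pow, Real.sq_sqrt h0.le, one_pow]
    have hn : eLpNorm (fun x => c * u x) 2 volume = 1 := by
      have h1 : ∫⁻ x, ‖c * u x‖ₑ ^ (2 : ℝ) = lpow 2 (fun x => c * u x) := by
        unfold lpow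
        refine lintegral_congr fun x => ?_
        rw [← ofReal_norm, ENNReal.ofReal_rpow_of_nonneg (norm_nonneg _) (by norm_num)]
        simp
      rw [eLpNorm_eq_lintegral_rpow_enorm_toReal (by norm_num) (by norm_num),
        ENNReal.toReal_ofNat, h1, lpow_two_const_mul, ← MemLp.ofReal_integral_sq hL2, ← ht,
        ← ENNReal.ofReal_mul (by positivity), hc2, one_div_mul_cancel h0.ne']
      simp
    have := hK _ (spaceX0_const_mul hu c) hn
    rw [energyOn_const_mul, hc2, one_div_mul_eq_div, le_div_iff₀ h0] at this
    exact this

theorem mem_spaceX0_univ {V u : ℝ → ℝ} : u ∈ spaceX0 V Set.univ ↔ u ∈ spaceX V := by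
  simp [spaceX0]

theorem energyOn_univ (V u : ℝ → ℝ) : energyOn V Set.univ u = energy V u := by
  simp [energyOn, energy]

theorem exists_mul_integral_sq_le_energy {V : ℝ → ℝ} (hV : CondV2 V) :
    ∃ l : ℝ, 0 < l ∧ ∀ u ∈ spaceX V, l * ∫ x, u x ^ 2 ≤ energy V u := by
  -- `λ₁` is an extended real, possibly `⊤`; a real number strictly between `0` and `λ₁` replaces
  -- it.
  obtain ⟨l, hl0, hl⟩ := EReal.lt_iff_exists_real_btwn.1 hV
  refine ⟨l, by exact_mod_cast hl0, fun u hu => ?_⟩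
  rw [← energyOn_univ]
  refine mul_integral_sq_le_energyOn (fun v hv hn => ?_) (mem_spaceX0_univ.2 hu)
  rw [energyOn_univ]
  have : lambda1 V ≤ ((energy V v : ℝ) : EReal) :=
    iInf₂_le v ⟨mem_spaceX0_univ.1 hv, hn⟩
  exact_mod_cast hl.le.trans this

theorem eventually_mul_integral_sq_le_energyOn {V : ℝ → ℝ} (hV : CondV3 V) (K : ℝ) :
    ∀ᶠ R : ℝ in atTop, ∀ u ∈ spaceX0 V (Metric.closedBall (0 : ℝ) R)ᶜ,
      K * ∫ x, u x ^ 2 ≤ energyOn V (Metric.closedBall (0 : ℝ) R)ᶜ u := by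
  filter_upwards [EReal.tendsto_nhds_top_iff_real.1 hV K] with R hR u hu
  refine mul_integral_sq_le_energyOn (fun v hv hn => ?_) hu
  have hne : (Metric.closedBall (0 : ℝ) R)ᶜ.Nonempty :=
    ⟨|R| + 1, by
      simp only [Set.mem_compl_iff, Metric.mem_closedBall, dist_zero_right, Real.norm_eq_abs,
        not_le]
      have := le_abs_self R
      have := le_abs_self (|R| + 1)
      linarith⟩
  unfold nu at hR
  rw [if_pos hne] at hR
  have := iInf₂_le (f := fun (u : ℝ → ℝ) (_ : u ∈ {u : ℝ → ℝ |
    u ∈ spaceX0 V (Metric.closedBall (0 : ℝ) R)ᶜ ∧ eLpNorm u 2 volume = 1}) =>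
      ((energyOn V (Metric.closedBall (0 : ℝ) R)ᶜ u : ℝ) : EReal)) v ⟨hv, hn⟩
  exact_mod_cast hR.le.trans this

/-- The norm of `X` controls the norm of `H^{1/2}(ℝ)`. -/
theorem exists_bound_of_energy {V : ℝ → ℝ} (hV1 : CondV1 V) (hV2 : CondV2 V) :
    ∃ C : ℝ, 0 < C ∧ ∀ u ∈ spaceX V, ∀ E : ℝ, energy V u ≤ E →
      lpow 2 u ≤ ENNReal.ofReal (C * E) ∧ lgagliardoSq u ≤ ENNReal.ofReal (C * E) := by
  obtain ⟨B, hB, hVB⟩ := hV1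
  obtain ⟨l, hl, H⟩ := exists_mul_integral_sq_le_energy hV2
  have hpi := Real.pi_pos
  -- The first summand serves `∫ u² ≤ E / l`; the second serves the semi-norm, as `V ≥ -B` leaves at
  -- most `E + B * (E / l)` for its share of the energy.
  refine ⟨1 / l + 2 * Real.pi * (1 + B / l), by positivity, fun u hu E hE => ?_⟩
  have h1 := (H u hu).trans hE
  have hI : ∫ x, u x ^ 2 ≤ E / l := by rw [le_div_iff₀ hl]; linarith
  have hI0 : 0 ≤ ∫ x, u x ^ 2 := integral_nonneg fun x => sq_nonneg _
  have hE0 : 0 ≤ E := le_trans (by positivity) h1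
  have hlow : -B * ∫ x, u x ^ 2 ≤ ∫ x, V x * u x ^ 2 := by
    rw [← integral_const_mul]
    refine integral_mono (hu.1.1.integrable_sq.const_mul _) hu.2 fun x => ?_
    exact mul_le_mul_of_nonneg_right (hVB x) (sq_nonneg _)
  have hg : gagliardoSq u ≤ 2 * Real.pi * (E + B * (E / l)) := by
    have h2 : 1 / (2 * Real.pi) * gagliardoSq u ≤ E + B * (E / l) := by
      have : B * ∫ x, u x ^ 2 ≤ B * (E / l) := by gcongr
      unfold energy at hE
      linarith
    rw [one_div_mul_eq_div, div_le_iff₀ (by positivity)] at h2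
    linarith
  rw [← MemLp.ofReal_integral_sq hu.1.1, ← hu.1.ofReal_gagliardoSq]
  constructor <;> refine ENNReal.ofReal_le_ofReal ?_
  · refine hI.trans ?_
    have : 0 ≤ 2 * Real.pi * (1 + B / l) * E := by positivity
    have e : E / l = 1 / l * E := by ring
    rw [e]; linarith
  · refine hg.trans ?_
    have : 0 ≤ 1 / l * E := by positivity
    have e : 2 * Real.pi * (E + B * (E / l)) = 2 * Real.pi * (1 + B / l) * E := by ring
    rw [e]; linarith

/-! ### Decay at infinity -/

/-- A Lipschitz function vanishing on `[-R, R]` and equal to one outside `[-R-1, R+1]`. -/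
noncomputable def outerCutoff (R x : ℝ) : ℝ :=
  min 1 (max 0 (|x| - R))

theorem continuous_outerCutoff (R : ℝ) : Continuous (outerCutoff R) := by
  unfold outerCutoff; fun_prop

theorem outerCutoff_nonneg (R x : ℝ) : 0 ≤ outerCutoff R x :=
  le_min zero_le_one (le_max_left _ _)

theorem outerCutoff_le_one (R x : ℝ) : outerCutoff R x ≤ 1 :=
  min_le_left _ _

theorem outerCutoff_sq_le_one (R x : ℝ) : outerCutoff R x ^ 2 ≤ 1 :=
  pow_le_one₀ (outerCutoff_nonneg R x) (outerCutoff_le_one R x)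

theorem outerCutoff_eq_zero {R x : ℝ} (h : |x| ≤ R) : outerCutoff R x = 0 := by
  rw [outerCutoff, max_eq_left (by linarith), min_eq_right zero_le_one]

theorem outerCutoff_eq_one {R x : ℝ} (h : R + 1 ≤ |x|) : outerCutoff R x = 1 := by
  rw [outerCutoff, min_eq_left]
  exact le_max_of_le_right (by linarith)

theorem abs_outerCutoff_sub_le (R x y : ℝ) : |outerCutoff R x - outerCutoff R y| ≤ |x - y| := by
  unfold outerCutoff
  calc _ ≤ max |(1 : ℝ) - 1| |max 0 (|x| - R) - max 0 (|y| - R)| := abs_min_sub_min_le_max ..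
    _ ≤ max |(1 : ℝ) - 1| (max |(0 : ℝ) - 0| |(|x| - R) - (|y| - R)|) := by
        gcongr; exact abs_max_sub_max_le_max ..
    _ ≤ |x - y| := by
        have := abs_abs_sub_abs_le_abs_sub x y
        simp [this]

/-- The quotient is at most `min 1 (1 / t ^ 2)` with `t = x - y`. The bound is integrable in `t` and
independent of `R`. -/
theorem outerCutoff_sub_sq_div_le (R x y : ℝ) :
    (outerCutoff R x - outerCutoff R y) ^ 2 / |x - y| ^ 2 ≤ 2 * (1 + (x - y) ^ 2)⁻¹ := by
  rcases eq_or_ne x y with rfl | hxy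
  · simp
  have h0 : 0 < (x - y) ^ 2 := by
    have := sub_ne_zero.2 hxy
    positivity
  have h1 : (outerCutoff R x - outerCutoff R y) ^ 2 ≤ (x - y) ^ 2 :=
    sq_le_sq.2 (abs_outerCutoff_sub_le R x y)
  have h2 : (outerCutoff R x - outerCutoff R y) ^ 2 ≤ 1 := by
    rw [sq_le_one_iff_abs_le_one, abs_le]
    constructor <;>
    linarith [outerCutoff_nonneg R x, outerCutoff_le_one R x, outerCutoff_nonneg R y,
      outerCutoff_le_one R y]
  rw [sq_abs, ← div_eq_mul_inv, div_le_div_iff₀ h0 (by positivity)]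
  nlinarith

/-- With `χ` the cutoff, `χ(x)u(x) - χ(y)u(y) = χ(y)(u(x) - u(y)) + (χ(x) - χ(y))u(x)`. Squaring
costs a factor two, and `4π` is the integral of `4 / (1 + t ^ 2)`. Uniformity in `R` is essential
for the tail estimate. -/
theorem lgagliardoSq_outerCutoff_mul_le {u : ℝ → ℝ} (hu : AEMeasurable u) (R : ℝ) :
    lgagliardoSq (fun x => outerCutoff R x * u x) ≤
      2 * lgagliardoSq u + ENNReal.ofReal (4 * Real.pi) * lpow 2 u := by
  have hc := continuous_outerCutoff R
  have h1 : ENNReal.ofReal (4 * Real.pi) * lpow 2 u = ∫⁻ x, ∫⁻ y,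
      ENNReal.ofReal (4 * (1 + (x - y) ^ 2)⁻¹) * ENNReal.ofReal (|u x| ^ 2) := by
    unfold lpow
    rw [← lintegral_const_mul' _ _ ENNReal.ofReal_ne_top]
    refine lintegral_congr fun x => ?_
    rw [lintegral_mul_const' _ _ (by simp)]
    congr 1
    rw [lintegral_sub_left_eq_self (fun t => ENNReal.ofReal (4 * (1 + t ^ 2)⁻¹)) x,
      ← ofReal_integral_eq_lintegral_ofReal (integrable_inv_one_add_sq.const_mul 4)
        (ae_of_all _ fun t => by positivity), integral_const_mul, integral_univ_inv_one_add_sq]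
  rw [h1]
  unfold lgagliardoSq
  rw [← lintegral_const_mul' _ _ (by simp),
    ← lintegral_add_left' ((aemeasurable_gagliardoDensity hu).const_mul _)]
  refine lintegral_mono fun x => ?_
  unfold gagliardoDensity
  rw [← lintegral_const_mul' _ _ (by simp), ← lintegral_add_left' (by fun_prop)]
  refine lintegral_mono fun y => ?_
  rw [show (2 : ℝ≥0∞) = ENNReal.ofReal 2 by simp, ← ENNReal.ofReal_mul (by positivity),
    ← ENNReal.ofReal_mul (by positivity), ← ENNReal.ofReal_add (by positivity) (by positivity)]
  refine ENNReal.ofReal_le_ofReal ?_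
  have h2 := mul_le_mul_of_nonneg_right (outerCutoff_sub_sq_div_le R x y) (sq_nonneg (u x))
  have h3 : outerCutoff R y ^ 2 * ((u x - u y) ^ 2 / |x - y| ^ 2) ≤
      1 * ((u x - u y) ^ 2 / |x - y| ^ 2) := by
    gcongr; exact outerCutoff_sq_le_one R y
  have h4 : (outerCutoff R x * u x - outerCutoff R y * u y) ^ 2 / |x - y| ^ 2 ≤
      2 * (outerCutoff R y ^ 2 * ((u x - u y) ^ 2 / |x - y| ^ 2)) +
      2 * ((outerCutoff R x - outerCutoff R y) ^ 2 / |x - y| ^ 2 * u x ^ 2) := by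
    rw [show 2 * (outerCutoff R y ^ 2 * ((u x - u y) ^ 2 / |x - y| ^ 2)) +
      2 * ((outerCutoff R x - outerCutoff R y) ^ 2 / |x - y| ^ 2 * u x ^ 2) =
      (2 * (outerCutoff R y * (u x - u y)) ^ 2 +
        2 * ((outerCutoff R x - outerCutoff R y) * u x) ^ 2) / |x - y| ^ 2 by ring]
    gcongr
    nlinarith [sq_nonneg (outerCutoff R y * (u x - u y) -
      (outerCutoff R x - outerCutoff R y) * u x)]
  rw [sq_abs (u x)]
  linarith

theorem outerCutoff_mul_mem_spaceX0 {V u : ℝ → ℝ} (hu : u ∈ spaceX V) (R : ℝ) :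
    (fun x => outerCutoff R x * u x) ∈ spaceX0 V (Metric.closedBall (0 : ℝ) R)ᶜ := by
  have hc := continuous_outerCutoff R
  obtain ⟨h1, h2, h3⟩ := memHHalf_iff.1 hu.1
  refine ⟨⟨memHHalf_iff.2 ⟨hc.aestronglyMeasurable.mul h1, ?_, ?_⟩, ?_⟩, ae_of_all _ fun x hx => ?_⟩
  · refine lt_of_le_of_lt (lintegral_mono fun x => ENNReal.ofReal_le_ofReal ?_) h2
    rw [abs_mul, mul_pow, sq_abs]
    exact mul_le_of_le_one_left (by positivity) (outerCutoff_sq_le_one R x)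
  · exact (lgagliardoSq_outerCutoff_mul_le h1.aemeasurable R).trans_lt
      (ENNReal.add_lt_top.2 ⟨ENNReal.mul_lt_top (by simp) h3, ENNReal.mul_lt_top ENNReal.ofReal_lt_top h2⟩)
  · have : Integrable (fun x => outerCutoff R x ^ 2 * (V x * u x ^ 2)) :=
      hu.2.bdd_mul (c := 1) (hc.pow 2).aestronglyMeasurable (ae_of_all _ fun x => by
        rw [Real.norm_eq_abs, abs_of_nonneg (sq_nonneg _)]; exact outerCutoff_sq_le_one R x)
    refine this.congr (ae_of_all _ fun x => ?_)
    ring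
  · have : |x| ≤ R := by simpa using hx
    simp [outerCutoff_eq_zero this]

/-- Functions in a ball of `X` have uniformly small mass far out. -/
theorem exists_tail_le {V : ℝ → ℝ} (hV1 : CondV1 V) (hV2 : CondV2 V) (hV3 : CondV3 V)
    (E : ℝ) {ε : ℝ} (hε : 0 < ε) : ∃ R : ℕ, ∀ u ∈ spaceX V, energy V u ≤ E →
      ∫⁻ x in (Set.Ico (-(R : ℝ)) R)ᶜ, ENNReal.ofReal (u x ^ 2) ≤ ENNReal.ofReal ε := by
  obtain ⟨C, hC, hbd⟩ := exists_bound_of_energy hV1 hV2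
  obtain ⟨B, hB, hVB⟩ := hV1
  have hpi := Real.pi_pos
  set N : ℝ := C * max E 0 with hN
  have hN0 : 0 ≤ N := by positivity
  set D : ℝ := 1 / (2 * Real.pi) * (2 * N + 4 * Real.pi * N) + (max E 0 + B * N) with hD
  have hD0 : 0 ≤ D := by positivity
  -- `D` bounds the energy of the cutoff function for every `R`, so `R` may be chosen after it.
  -- Using `D + 1` keeps the factor to be cancelled positive.
  obtain ⟨R, hR, hR0⟩ := ((eventually_mul_integral_sq_le_energyOn hV3 ((D + 1) / ε)).and
    (eventually_ge_atTop (0 : ℝ))).exists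
  -- The cutoff equals one only from `R + 1` on. An integer radius lets the grid cells tile the
  -- interval later.
  obtain ⟨m, hm⟩ := exists_nat_ge (R + 1)
  refine ⟨m, fun u hu hE => ?_⟩
  obtain ⟨hI, hG⟩ := hbd u hu (max E 0) (hE.trans (le_max_left _ _))
  set w : ℝ → ℝ := fun x => outerCutoff R x * u x with hw
  have hwX := outerCutoff_mul_mem_spaceX0 hu R
  have hkey := hR w hwX
  have hum : AEMeasurable u := hu.1.1.1.aemeasurable
  have hI' : ∫ x, u x ^ 2 ≤ N := by
    rw [← MemLp.ofReal_integral_sq hu.1.1] at hI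
    exact (ENNReal.ofReal_le_ofReal_iff hN0).1 hI
  have hgw : gagliardoSq w ≤ 2 * N + 4 * Real.pi * N := by
    rw [← ENNReal.ofReal_le_ofReal_iff (by positivity), hwX.1.1.ofReal_gagliardoSq]
    refine (lgagliardoSq_outerCutoff_mul_le hum R).trans ?_
    rw [ENNReal.ofReal_add (by positivity) (by positivity), ENNReal.ofReal_mul (p := 2) (by positivity),
      ENNReal.ofReal_mul (p := 4 * Real.pi) (by positivity), ENNReal.ofReal_ofNat]
    gcongr
  -- `V` may be negative, so the factor `χ ^ 2 ≤ 1` can be dropped only after adding `B * u ^ 2`.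
  have hVw : ∫ x in (Metric.closedBall (0 : ℝ) R)ᶜ, V x * w x ^ 2 ≤ max E 0 + B * N := by
    have hint : Integrable (fun x => V x * u x ^ 2 + B * u x ^ 2) :=
      hu.2.add (hu.1.1.integrable_sq.const_mul B)
    have hnn : ∀ x, 0 ≤ V x * u x ^ 2 + B * u x ^ 2 := fun x => by
      rw [← add_mul]; exact mul_nonneg (by linarith [hVB x]) (sq_nonneg _)
    calc ∫ x in (Metric.closedBall (0 : ℝ) R)ᶜ, V x * w x ^ 2
        ≤ ∫ x in (Metric.closedBall (0 : ℝ) R)ᶜ, (V x * u x ^ 2 + B * u x ^ 2) := by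
          refine integral_mono hwX.1.2.integrableOn hint.integrableOn fun x => ?_
          have h1 := mul_le_mul_of_nonneg_right (outerCutoff_sq_le_one R x) (hnn x)
          have h2 : 0 ≤ outerCutoff R x ^ 2 * (B * u x ^ 2) := by positivity
          simp only [hw]
          nlinarith
      _ ≤ ∫ x, (V x * u x ^ 2 + B * u x ^ 2) :=
          setIntegral_le_integral hint (ae_of_all _ hnn)
      _ = (∫ x, V x * u x ^ 2) + B * ∫ x, u x ^ 2 := by
          rw [integral_add hu.2 (hu.1.1.integrable_sq.const_mul B), integral_const_mul]
      _ ≤ max E 0 + B * N := by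
          have h1 : (∫ x, V x * u x ^ 2) ≤ energy V u := by
            unfold energy
            have := gagliardoSq_nonneg u
            have : 0 ≤ 1 / (2 * Real.pi) * gagliardoSq u := by positivity
            linarith
          have h2 := le_max_left E 0
          gcongr
          linarith
  have hEw : energyOn V (Metric.closedBall (0 : ℝ) R)ᶜ w ≤ D := by
    unfold energyOn
    rw [hD]
    gcongr
  have hsmall : ∫ x, w x ^ 2 ≤ ε := by
    have h1 := hkey.trans hEw
    rw [div_mul_eq_mul_div, div_le_iff₀ hε] at h1
    have h2 : (D + 1) * ∫ x, w x ^ 2 ≤ (D + 1) * ε := by linarith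
    exact le_of_mul_le_mul_left h2 (by positivity)
  calc ∫⁻ x in (Set.Ico (-(m : ℝ)) m)ᶜ, ENNReal.ofReal (u x ^ 2)
      ≤ ∫⁻ x in (Set.Ico (-(m : ℝ)) m)ᶜ, ENNReal.ofReal (|w x| ^ 2) := by
        refine setLIntegral_mono' measurableSet_Ico.compl fun x hx => ?_
        have : R + 1 ≤ |x| := by
          by_contra! h
          rw [abs_lt] at h
          exact hx ⟨by linarith, by linarith⟩
        simp [hw, outerCutoff_eq_one this]
    _ ≤ lpow 2 w := setLIntegral_le_lintegral _ _
    _ ≤ ENNReal.ofReal ε := by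
        rw [← MemLp.ofReal_integral_sq hwX.1.1.1]
        exact ENNReal.ofReal_le_ofReal hsmall

/-! ### Local compactness -/

/-- A pointwise Poincaré inequality: within the cell `|x - y| ≤ s`, so the mean square deviation of
`w` from `w x` is paid for by the Gagliardo density at `x`. -/
theorem sq_le_gagliardoDensity_add_sq_average {w : ℝ → ℝ} (hw : MemLp w 2 volume) {a s : ℝ}
    (hs : 0 < s) {x : ℝ} (hx : x ∈ Set.Ico a (a + s)) :
    ENNReal.ofReal (w x ^ 2) ≤ ENNReal.ofReal (2 * s) * gagliardoDensity w x +
      ENNReal.ofReal (4 / s ^ 2 * (∫ y in Set.Ico a (a + s), w y) ^ 2) := by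
  set A := ∫ y in Set.Ico a (a + s), w y with hA
  set Q := ∫ y in Set.Ico a (a + s), (w x - w y) ^ 2 with hQ
  have hwI : IntegrableOn w (Set.Ico a (a + s)) :=
    (hw.restrict _).integrable (by norm_num)
  have hwI2 : IntegrableOn (fun y => w y ^ 2) (Set.Ico a (a + s)) := hw.integrable_sq.integrableOn
  have hexp : (fun y => (w x - w y) ^ 2) = fun y => (w x ^ 2 - 2 * w x * w y) + w y ^ 2 := by
    ext y; ring
  have hc : IntegrableOn (fun _ : ℝ => w x ^ 2) (Set.Ico a (a + s)) := by simp
  have hcw := Integrable.const_mul hwI (2 * w x)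
  have hsub : Integrable (fun y => w x ^ 2 - 2 * w x * w y)
      (volume.restrict (Set.Ico a (a + s))) := Integrable.sub hc hcw
  have hint : IntegrableOn (fun y => (w x - w y) ^ 2) (Set.Ico a (a + s)) := by
    rw [hexp]; exact Integrable.add hsub hwI2
  have hQA : s * w x ^ 2 - 2 * w x * A ≤ Q := by
    have h1 : Q = s * w x ^ 2 - 2 * w x * A + ∫ y in Set.Ico a (a + s), w y ^ 2 := by
      rw [hQ, hexp, integral_add hsub hwI2,
        integral_sub hc hcw, integral_const_mul, ← hA]
      simp [hs.le]
    have h2 : 0 ≤ ∫ y in Set.Ico a (a + s), w y ^ 2 := integral_nonneg fun y => sq_nonneg _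
    linarith
  have hQ0 : 0 ≤ Q := integral_nonneg fun y => sq_nonneg _
  -- The cross term in `hQA` is absorbed by `4 * s * w x * A ≤ s ^ 2 * w x ^ 2 + 4 * A ^ 2`.
  have hreal : w x ^ 2 ≤ 2 / s * Q + 4 / s ^ 2 * A ^ 2 := by
    have h1 : 0 ≤ (s * w x - 2 * A) ^ 2 := sq_nonneg _
    have h2 : s ^ 2 * w x ^ 2 ≤ 2 * s * Q + 4 * A ^ 2 := by
      have := mul_le_mul_of_nonneg_left hQA hs.le
      nlinarith
    have h3 : 2 / s * Q + 4 / s ^ 2 * A ^ 2 = (2 * s * Q + 4 * A ^ 2) / s ^ 2 := by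
      field_simp
    rw [h3, le_div_iff₀ (by positivity)]
    linarith
  have hQG : ENNReal.ofReal Q ≤ ENNReal.ofReal (s ^ 2) * gagliardoDensity w x := by
    rw [hQ, ofReal_integral_eq_lintegral_ofReal hint (ae_of_all _ fun y => sq_nonneg _)]
    unfold gagliardoDensity
    rw [← lintegral_const_mul' _ _ (by simp)]
    refine (setLIntegral_mono' measurableSet_Ico fun y hy => ?_).trans
      (setLIntegral_le_lintegral _ _)
    rw [← ENNReal.ofReal_mul (by positivity)]
    refine ENNReal.ofReal_le_ofReal ?_
    rcases eq_or_ne x y with rfl | hxy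
    · simp
    have h0 : 0 < |x - y| ^ 2 := by
      have := sub_ne_zero.2 hxy
      positivity
    have h1 : |x - y| ^ 2 ≤ s ^ 2 := by
      have : |x - y| ≤ s := by rw [abs_le]; constructor <;> linarith [hx.1, hx.2, hy.1, hy.2]
      gcongr
    rw [← mul_div_assoc, le_div_iff₀ h0, mul_comm]
    gcongr
  refine (ENNReal.ofReal_le_ofReal hreal).trans ?_
  rw [ENNReal.ofReal_add (by positivity) (by positivity), ENNReal.ofReal_mul (by positivity)]
  refine add_le_add_left ?_ _
  calc ENNReal.ofReal (2 / s) * ENNReal.ofReal Q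
      ≤ ENNReal.ofReal (2 / s) * (ENNReal.ofReal (s ^ 2) * gagliardoDensity w x) := by gcongr
    _ = ENNReal.ofReal (2 * s) * gagliardoDensity w x := by
      rw [← mul_assoc, ← ENNReal.ofReal_mul (by positivity)]
      congr 2; field_simp

/-- The integral over the `k`-th cell of the grid of mesh `1 / (n + 1)`. -/
noncomputable def cellIntegral (u : ℝ → ℝ) (i : ℕ × ℤ) : ℝ :=
  ∫ y in Set.Ico ((i.2 : ℝ) / (i.1 + 1)) (i.2 / (i.1 + 1) + 1 / (i.1 + 1)), u y

/-- The semi-norm carries a factor that vanishes as the mesh shrinks; the rest involves finitely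
many linear functionals. Crudely, the term of the cell containing `x` is replaced by the sum `S`
over all cells, so integration just multiplies by `2 * R`. -/
theorem setLIntegral_sq_le_cellIntegral {w : ℝ → ℝ} (hw : MemLp w 2 volume) (n R : ℕ) :
    ∫⁻ x in Set.Ico (-(R : ℝ)) R, ENNReal.ofReal (w x ^ 2) ≤
      ENNReal.ofReal (2 * (1 / (n + 1))) * lgagliardoSq w +
      ENNReal.ofReal ((∑ k ∈ Finset.Ico (-(R * (n + 1) : ℤ)) (R * (n + 1)),
        4 / (1 / ((n : ℝ) + 1)) ^ 2 * cellIntegral w (n, k) ^ 2) * (2 * R)) := by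
  set S := ∑ k ∈ Finset.Ico (-(R * (n + 1) : ℤ)) (R * (n + 1)),
        4 / (1 / ((n : ℝ) + 1)) ^ 2 * cellIntegral w (n, k) ^ 2 with hS
  have hS0 : 0 ≤ S := Finset.sum_nonneg fun k _ => by positivity
  have hn : (0 : ℝ) < n + 1 := by positivity
  have hpt : ∀ x ∈ Set.Ico (-(R : ℝ)) R, ENNReal.ofReal (w x ^ 2) ≤
      ENNReal.ofReal (2 * (1 / (n + 1))) * gagliardoDensity w x + ENNReal.ofReal S := by
    intro x hx
    set k := ⌊x * (n + 1)⌋ with hk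
    have h1 : (k : ℝ) ≤ x * (n + 1) := Int.floor_le _
    have h2 : x * (n + 1) < k + 1 := Int.lt_floor_add_one _
    have hmem : x ∈ Set.Ico ((k : ℝ) / (n + 1)) (k / (n + 1) + 1 / (n + 1)) := by
      constructor
      · rwa [div_le_iff₀ hn]
      · rwa [← add_div, lt_div_iff₀ hn]
    have hk1 : -(R * (n + 1) : ℤ) ≤ k := by
      rw [hk, Int.le_floor]
      push_cast
      nlinarith [hx.1]
    have hk2 : k < (R * (n + 1) : ℤ) := by
      rw [hk, Int.floor_lt]
      push_cast
      nlinarith [hx.2]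
    refine (sq_le_gagliardoDensity_add_sq_average hw (by positivity) hmem).trans ?_
    gcongr
    refine Finset.single_le_sum (f := fun k : ℤ => 4 / (1 / ((n : ℝ) + 1)) ^ 2 *
      cellIntegral w (n, k) ^ 2) (fun k _ => by positivity) (Finset.mem_Ico.2 ⟨hk1, hk2⟩)
  calc ∫⁻ x in Set.Ico (-(R : ℝ)) R, ENNReal.ofReal (w x ^ 2)
      ≤ ∫⁻ x in Set.Ico (-(R : ℝ)) R,
          (ENNReal.ofReal (2 * (1 / (n + 1))) * gagliardoDensity w x + ENNReal.ofReal S) :=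
        setLIntegral_mono' measurableSet_Ico hpt
    _ = ENNReal.ofReal (2 * (1 / (n + 1))) *
          (∫⁻ x in Set.Ico (-(R : ℝ)) R, gagliardoDensity w x) + ENNReal.ofReal (S * (2 * R)) := by
        rw [lintegral_add_right _ measurable_const, lintegral_const_mul' _ _ ENNReal.ofReal_ne_top,
          setLIntegral_const, Real.volume_Ico, ← ENNReal.ofReal_mul hS0]
        congr 3; ring
    _ ≤ _ := by
        gcongr
        exact setLIntegral_le_lintegral _ _

theorem abs_cellIntegral_le {u : ℝ → ℝ} (hu : MemLp u 2 volume) (i : ℕ × ℤ) :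
    |cellIntegral u i| ≤ 1 + ∫ x, u x ^ 2 := by
  unfold cellIntegral
  set s : ℝ := 1 / (i.1 + 1) with hs
  have hs0 : 0 ≤ s := by positivity
  have hs1 : s ≤ 1 := by
    rw [hs, div_le_one (by positivity)]
    have : (0 : ℝ) ≤ i.1 := by positivity
    linarith
  set I := Set.Ico ((i.2 : ℝ) / (i.1 + 1)) (i.2 / (i.1 + 1) + s)
  have h1 : IntegrableOn u I := (hu.restrict _).integrable (by norm_num)
  have h2 : IntegrableOn (fun y => u y ^ 2) I := hu.integrable_sq.integrableOn
  have hc : IntegrableOn (fun _ : ℝ => (1 : ℝ)) I := by simp [I]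
  calc |∫ y in I, u y| ≤ ∫ y in I, |u y| := abs_integral_le_integral_abs
    _ ≤ ∫ y in I, (1 + u y ^ 2) := by
        refine integral_mono h1.abs (hc.add h2) fun y => ?_
        simp only
        rw [← sq_abs]
        nlinarith [sq_nonneg (|u y| - 1)]
    _ = s + ∫ y in I, u y ^ 2 := by
        rw [integral_add hc h2]
        simp [I, hs0]
    _ ≤ 1 + ∫ x, u x ^ 2 := add_le_add hs1
        (setIntegral_le_integral hu.integrable_sq (ae_of_all _ fun y => sq_nonneg _))

theorem cellIntegral_sub {u v : ℝ → ℝ} (hu : MemLp u 2 volume) (hv : MemLp v 2 volume)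
    (i : ℕ × ℤ) :
    cellIntegral (fun x => u x - v x) i = cellIntegral u i - cellIntegral v i :=
  integral_sub ((hu.restrict _).integrable (by norm_num)) ((hv.restrict _).integrable (by norm_num))

/-- Tychonoff in place of a diagonal argument: a countable product of compact intervals is compact
and first countable, hence sequentially compact. -/
theorem exists_subseq_tendsto_of_bounded {ι : Type*} [Countable ι] {a : ℕ → ι → ℝ} {K : ℝ}
    (ha : ∀ n i, |a n i| ≤ K) :
    ∃ (l : ι → ℝ) (φ : ℕ → ℕ), StrictMono φ ∧
      ∀ i, Tendsto (fun n => a (φ n) i) atTop (𝓝 (l i)) := by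
  have hK : IsCompact (Set.univ.pi fun _ : ι => Metric.closedBall (0 : ℝ) K) :=
    isCompact_univ_pi fun _ => isCompact_closedBall 0 K
  obtain ⟨l, -, φ, hφ, h⟩ := hK.tendsto_subseq (x := a) fun n i _ => by simpa using ha n i
  exact ⟨l, φ, hφ, fun i => tendsto_pi_nhds.1 h i⟩

theorem ofReal_sub_sq_le (a b : ℝ) : ENNReal.ofReal ((a - b) ^ 2) ≤
    2 * ENNReal.ofReal (a ^ 2) + 2 * ENNReal.ofReal (b ^ 2) := by
  rw [show (2 : ℝ≥0∞) = ENNReal.ofReal 2 by simp, ← ENNReal.ofReal_mul (by positivity),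
    ← ENNReal.ofReal_mul (by positivity), ← ENNReal.ofReal_add (by positivity) (by positivity)]
  exact ENNReal.ofReal_le_ofReal (by nlinarith [sq_nonneg (a + b)])

theorem cauchy_lpow_two_of_cellIntegral {N : ℝ} {u : ℕ → ℝ → ℝ}
    (hu : ∀ n, MemLp (u n) 2 volume) (hE : ∀ n, lgagliardoSq (u n) ≤ ENNReal.ofReal N)
    (htail : ∀ ε : ℝ, 0 < ε → ∃ R : ℕ, ∀ n,
      ∫⁻ x in (Set.Ico (-(R : ℝ)) R)ᶜ, ENNReal.ofReal (u n x ^ 2) ≤ ENNReal.ofReal ε)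
    {l : ℕ × ℤ → ℝ} (hl : ∀ i, Tendsto (fun n => cellIntegral (u n) i) atTop (𝓝 (l i)))
    {ε : ℝ} (hε : 0 < ε) : ∃ n₀, ∀ i ≥ n₀, ∀ j ≥ n₀,
      lpow 2 (fun x => u i x - u j x) ≤ ENNReal.ofReal ε := by
  -- Since `(a - b) ^ 2 ≤ 2 * a ^ 2 + 2 * b ^ 2`, two tails of `ε / 12` give `ε / 3`.
  obtain ⟨R, hR⟩ := htail (ε / 12) (by positivity)
  -- Differences have squared semi-norm at most `4 * N`; this mesh makes `2 / (m + 1) * (4 * N) ≤ ε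
  -- / 3`.
  obtain ⟨m, hm⟩ := exists_nat_ge (24 * N / ε)
  set F : ℕ × ℕ → ℝ := fun p => (∑ k ∈ Finset.Ico (-(R * (m + 1) : ℤ)) (R * (m + 1)),
    4 / (1 / ((m : ℝ) + 1)) ^ 2 * (cellIntegral (u p.1) (m, k) -
      cellIntegral (u p.2) (m, k)) ^ 2) * (2 * R) with hF
  have hF0 : Tendsto F (atTop ×ˢ atTop) (𝓝 0) := by
    have h1 : Tendsto F (atTop ×ˢ atTop)
        (𝓝 ((∑ k ∈ Finset.Ico (-(R * (m + 1) : ℤ)) (R * (m + 1)),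
          4 / (1 / ((m : ℝ) + 1)) ^ 2 * (l (m, k) - l (m, k)) ^ 2) * (2 * R))) := by
      refine Tendsto.mul_const _ (tendsto_finsetSum _ fun k _ => Tendsto.const_mul _ ?_)
      exact (((hl (m, k)).comp tendsto_fst).sub ((hl (m, k)).comp tendsto_snd)).pow 2
    simpa using h1
  have hev : ∀ᶠ p in atTop ×ˢ atTop, F p < ε / 3 := hF0.eventually_lt_const (by positivity)
  rw [prod_atTop_atTop_eq, eventually_atTop] at hev
  obtain ⟨⟨a, b⟩, hab⟩ := hev
  refine ⟨max a b, fun i hi j hj => ?_⟩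
  have hFij := (hab (i, j) ⟨(le_max_left _ _).trans hi, (le_max_right _ _).trans hj⟩).le
  have hin := setLIntegral_sq_le_cellIntegral ((hu i).sub (hu j)) m R
  have hGij : lgagliardoSq (fun x => u i x - u j x) ≤ ENNReal.ofReal (4 * N) := by
    refine (lgagliardoSq_sub_le (hu i).1.aemeasurable (hu j).1.aemeasurable).trans ?_
    calc _ ≤ 2 * ENNReal.ofReal N + 2 * ENNReal.ofReal N := by gcongr <;> exact hE _
      _ = ENNReal.ofReal (4 * N) := by
        rw [ENNReal.ofReal_mul (p := 4) (by norm_num), ← add_mul, ENNReal.ofReal_ofNat]; norm_num only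
  have hin' : ∫⁻ x in Set.Ico (-(R : ℝ)) R, ENNReal.ofReal ((u i x - u j x) ^ 2) ≤
      ENNReal.ofReal (ε / 3) + ENNReal.ofReal (ε / 3) := by
    refine hin.trans (add_le_add ?_ ?_)
    · refine (mul_le_mul_right hGij _).trans ?_
      rw [← ENNReal.ofReal_mul (by positivity)]
      refine ENNReal.ofReal_le_ofReal ?_
      rw [div_le_iff₀ hε] at hm
      have : 2 * (1 / ((m : ℝ) + 1)) * (4 * N) = 8 * N / (m + 1) := by ring
      rw [this, div_le_iff₀ (by positivity)]
      nlinarith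
    · refine ENNReal.ofReal_le_ofReal (le_trans (le_of_eq ?_) hFij)
      simp only [hF]
      congr 1
      refine Finset.sum_congr rfl fun k _ => ?_
      rw [← cellIntegral_sub (hu i) (hu j)]
      rfl
  have hout : ∫⁻ x in (Set.Ico (-(R : ℝ)) R)ᶜ, ENNReal.ofReal ((u i x - u j x) ^ 2) ≤
      ENNReal.ofReal (ε / 3) := by
    have hm1 : AEMeasurable (fun x => 2 * ENNReal.ofReal (u i x ^ 2))
        (volume.restrict (Set.Ico (-(R : ℝ)) R)ᶜ) :=
      (((hu i).1.aemeasurable.pow_const 2).ennreal_ofReal.const_mul _).restrict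
    refine (lintegral_mono fun x => ofReal_sub_sq_le (u i x) (u j x)).trans ?_
    rw [lintegral_add_left' hm1, lintegral_const_mul' _ _ (by simp),
      lintegral_const_mul' _ _ (by simp)]
    calc _ ≤ 2 * ENNReal.ofReal (ε / 12) + 2 * ENNReal.ofReal (ε / 12) := by
          gcongr <;> exact hR _
      _ = ENNReal.ofReal (ε / 3) := by
        rw [← add_mul, show (2 + 2 : ℝ≥0∞) = ENNReal.ofReal 4 by norm_num,
          ← ENNReal.ofReal_mul (by norm_num)]
        congr 1; ring
  calc lpow 2 (fun x => u i x - u j x)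
      = ∫⁻ x, ENNReal.ofReal ((u i x - u j x) ^ 2) := by simp only [lpow, sq_abs]
    _ = (∫⁻ x in Set.Ico (-(R : ℝ)) R, ENNReal.ofReal ((u i x - u j x) ^ 2)) +
        ∫⁻ x in (Set.Ico (-(R : ℝ)) R)ᶜ, ENNReal.ofReal ((u i x - u j x) ^ 2) :=
      (lintegral_add_compl _ measurableSet_Ico).symm
    _ ≤ (ENNReal.ofReal (ε / 3) + ENNReal.ofReal (ε / 3)) + ENNReal.ofReal (ε / 3) :=
      add_le_add hin' hout
    _ = ENNReal.ofReal ε := by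
      rw [← ENNReal.ofReal_add (by positivity) (by positivity),
        ← ENNReal.ofReal_add (by positivity) (by positivity)]
      congr 1; ring

theorem exists_eLpNorm_limit_of_cauchy {p : ℝ≥0∞} (hp : 1 ≤ p) {f : ℕ → ℝ → ℝ}
    (hf : ∀ n, MemLp (f n) p volume)
    (hc : ∀ ε : ℝ≥0∞, 0 < ε → ∃ n₀, ∀ i ≥ n₀, ∀ j ≥ n₀,
      eLpNorm (fun x => f i x - f j x) p volume < ε) :
    ∃ v : ℝ → ℝ, MemLp v p volume ∧
      Tendsto (fun n => eLpNorm (fun x => f n x - v x) p volume) atTop (𝓝 0) := by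
  have : Fact (1 ≤ p) := ⟨hp⟩
  have hcs : CauchySeq fun n => (hf n).toLp (f n) := by
    rw [EMetric.cauchySeq_iff]
    intro ε hε
    obtain ⟨n₀, h⟩ := hc ε hε
    refine ⟨n₀, fun i hi j hj => ?_⟩
    rw [Lp.edist_toLp_toLp]
    exact h i hi j hj
  obtain ⟨v, hv⟩ := cauchySeq_tendsto_of_complete hcs
  refine ⟨v, Lp.memLp v, ?_⟩
  have := (Lp.tendsto_Lp_iff_tendsto_eLpNorm'' f hf v (Lp.memLp v)).1 (by simpa using hv)
  exact this

/-! ### The embedding -/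

theorem memLp_of_mem_spaceX {V u : ℝ → ℝ} (hu : u ∈ spaceX V) {q : ℝ} (hq : 2 ≤ q) :
    MemLp u (ENNReal.ofReal q) volume := by
  obtain ⟨h1, h2, h3⟩ := memHHalf_iff.1 hu.1
  obtain ⟨c, -, H⟩ := exists_eLpNorm_rpow_le q hq ((lgagliardoSq u).toReal + 1) (by positivity)
  refine ⟨h1, (H u h1.aemeasurable ?_ ((lpow 2 u).toReal + 1) (by positivity) ?_).trans_lt
    ENNReal.ofReal_lt_top⟩
  · exact (ENNReal.ofReal_toReal h3.ne).symm.le.trans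
      (ENNReal.ofReal_le_ofReal (by linarith))
  · exact (ENNReal.ofReal_toReal h2.ne).symm.le.trans
      (ENNReal.ofReal_le_ofReal (by linarith))

theorem energy_const_mul (V : ℝ → ℝ) (c : ℝ) (u : ℝ → ℝ) :
    energy V (fun x => c * u x) = c ^ 2 * energy V u := by
  rw [← energyOn_univ, energyOn_const_mul, energyOn_univ]

theorem exists_eLpNorm_le_normX {V : ℝ → ℝ} (hV1 : CondV1 V) (hV2 : CondV2 V) {q : ℝ}
    (hq : 2 ≤ q) : ∃ C : ℝ, ∀ u ∈ spaceX V,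
      eLpNorm u (ENNReal.ofReal q) volume ≤ ENNReal.ofReal (C * normX V u) := by
  obtain ⟨C, hC, hbd⟩ := exists_bound_of_energy hV1 hV2
  obtain ⟨c, hc, H⟩ := exists_eLpNorm_rpow_le q hq C hC
  -- The moment bound is not homogeneous, so it is applied at energy at most one, where mass and
  -- semi-norm are both at most `C`, and then rescaled. If the energy is not positive, `u` vanishes
  -- almost everywhere.
  refine ⟨(c * C) ^ (1 / q), fun u hu => ?_⟩
  rcases le_or_gt (energy V u) 0 with h0 | h0
  · have h2 := (hbd u hu 0 h0).1
    rw [mul_zero, ENNReal.ofReal_zero, nonpos_iff_eq_zero, ← MemLp.ofReal_integral_sq hu.1.1,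
      ENNReal.ofReal_eq_zero] at h2
    have hz : (fun x => u x ^ 2) =ᵐ[volume] 0 :=
      (integral_eq_zero_iff_of_nonneg (fun x => sq_nonneg _) hu.1.1.integrable_sq).1
        (h2.antisymm (integral_nonneg fun x => sq_nonneg _))
    have hz' : u =ᵐ[volume] 0 := hz.mono fun x hx => by simpa using hx
    rw [eLpNorm_congr_ae hz', eLpNorm_zero]
    exact zero_le
  · set t := normX V u with ht
    have ht0 : 0 < t := Real.sqrt_pos.2 h0
    have ht2 : t ^ 2 = energy V u := Real.sq_sqrt h0.le
    have hw := spaceX_const_mul hu t⁻¹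
    have hEw : energy V (fun x => t⁻¹ * u x) ≤ 1 := by
      rw [energy_const_mul, ← ht2, ← mul_pow, inv_mul_cancel₀ ht0.ne', one_pow]
    obtain ⟨h2, hG⟩ := hbd _ hw 1 hEw
    rw [mul_one] at h2 hG
    have := H _ hw.1.1.1.aemeasurable hG C hC h2
    have huw : u = t • fun x => t⁻¹ * u x := by
      ext x; simp [ht0.ne']
    rw [huw, eLpNorm_const_smul, Real.enorm_eq_ofReal ht0.le, mul_comm,
      ENNReal.ofReal_mul (by positivity)]
    gcongr

theorem exists_subseq_tendsto_eLpNorm {V : ℝ → ℝ} (hV1 : CondV1 V) (hV2 : CondV2 V)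
    (hV3 : CondV3 V) {q : ℝ} (hq : 2 ≤ q) {u : ℕ → ℝ → ℝ} (hu : ∀ n, u n ∈ spaceX V) {M : ℝ}
    (hM : ∀ n, normX V (u n) ≤ M) :
    ∃ (v : ℝ → ℝ) (φ : ℕ → ℕ), MemLp v (ENNReal.ofReal q) volume ∧ StrictMono φ ∧
      Tendsto (fun n => eLpNorm (fun x => u (φ n) x - v x) (ENNReal.ofReal q) volume)
        atTop (𝓝 0) := by
  obtain ⟨C, hC, hbd⟩ := exists_bound_of_energy hV1 hV2
  have hq0 : 0 < q := by linarith
  set E : ℝ := M ^ 2 + 1 with hE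
  have hEn : ∀ n, energy V (u n) ≤ E := fun n => by
    have h0 : 0 ≤ M := (Real.sqrt_nonneg _).trans (hM n)
    have := (Real.sqrt_le_left h0).1 (hM n)
    linarith
  set N : ℝ := C * E with hN
  have hN0 : 0 < N := by positivity
  have hL2 : ∀ n, MemLp (u n) 2 volume := fun n => (hu n).1.1
  have hint : ∀ n, ∫ x, u n x ^ 2 ≤ N := fun n => by
    have := (hbd _ (hu n) E (hEn n)).1
    rw [← MemLp.ofReal_integral_sq (hL2 n)] at this
    exact (ENNReal.ofReal_le_ofReal_iff hN0.le).1 this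
  have hG : ∀ n, lgagliardoSq (u n) ≤ ENNReal.ofReal N := fun n => (hbd _ (hu n) E (hEn n)).2
  obtain ⟨l, φ, hφ, hl⟩ := exists_subseq_tendsto_of_bounded (a := fun n => cellIntegral (u n))
    (K := 1 + N) fun n i => (abs_cellIntegral_le (hL2 n) i).trans (by linarith [hint n])
  have hcauchy : ∀ ε : ℝ, 0 < ε → ∃ n₀, ∀ i ≥ n₀, ∀ j ≥ n₀,
      lpow 2 (fun x => u (φ i) x - u (φ j) x) ≤ ENNReal.ofReal ε := fun ε hε =>
    cauchy_lpow_two_of_cellIntegral (u := fun n => u (φ n)) (fun n => hL2 _)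
      (fun n => hG _) (fun ε hε => by
        obtain ⟨R, hR⟩ := exists_tail_le hV1 hV2 hV3 E hε
        exact ⟨R, fun n => hR _ (hu _) (hEn _)⟩) hl hε
  obtain ⟨c, hc, H⟩ := exists_eLpNorm_rpow_le q hq (4 * N) (by positivity)
  obtain ⟨v, hv, hlim⟩ := exists_eLpNorm_limit_of_cauchy (p := ENNReal.ofReal q)
    (f := fun n => u (φ n)) (by rw [ENNReal.one_le_ofReal]; linarith)
    (fun n => memLp_of_mem_spaceX (hu _) hq) (fun ε hε => by
      obtain ⟨η, hη0, hηε⟩ := ENNReal.lt_iff_exists_real_btwn.1 hε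
      have hη : 0 < η := by simpa using hηε.1
      -- This choice of `δ` solves `(c * δ) ^ (1 / q) = η`.
      obtain ⟨n₀, hn⟩ := hcauchy (η ^ q / c) (by positivity)
      refine ⟨n₀, fun i hi j hj => ?_⟩
      refine (H _ ((hL2 _).sub (hL2 _)).1.aemeasurable ?_ _ (by positivity)
        (hn i hi j hj)).trans_lt ?_
      · refine (lgagliardoSq_sub_le (hL2 _).1.aemeasurable (hL2 _).1.aemeasurable).trans ?_
        calc _ ≤ 2 * ENNReal.ofReal N + 2 * ENNReal.ofReal N := by gcongr <;> exact hG _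
          _ = ENNReal.ofReal (4 * N) := by
            rw [ENNReal.ofReal_mul (p := 4) (by norm_num), ← add_mul, ENNReal.ofReal_ofNat]; norm_num only
      · rw [mul_div_cancel₀ _ hc.ne', ← Real.rpow_mul hη.le, mul_one_div_cancel hq0.ne',
          Real.rpow_one]
        exact hηε.2)
  exact ⟨v, φ, hv, hφ, hlim⟩

end FracSchrodinger

theorem lemma2p2 (V : ℝ → ℝ) (hV : Continuous V)
    (hV1 : FracSchrodinger.CondV1 V) (hV2 : FracSchrodinger.CondV2 V)
    (hV3 : FracSchrodinger.CondV3 V) (q : ℝ) (hq : 2 ≤ q) :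
    FracSchrodinger.CompactlyEmbedded (FracSchrodinger.spaceX V) (FracSchrodinger.normX V)
      (ENNReal.ofReal q) := by
  exact ⟨fun _ hu => FracSchrodinger.memLp_of_mem_spaceX hu hq,
    FracSchrodinger.exists_eLpNorm_le_normX hV1 hV2 hq,
    fun _ hu ⟨_, hM⟩ => FracSchrodinger.exists_subseq_tendsto_eLpNorm hV1 hV2 hV3 hq hu hM⟩
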